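/- Let $A$ be a finite non-empty alphabet and let $w = a_0a_1a_2\cdots$ be an infinite word over $A$. A finite word $v$ is a \emph{complete first return} to a finite word $u$ if $v$ begins with $u$, ends with $u$, and contains exactly two (possibly overlapping) occurrences of $u$. The \emph{privileged} words over $A$ are defined recursively: the empty word is privileged, every letter of $A$ is privileged, and a word of length at least $2$ is privileged if and only if it is a complete first return to a shorter privileged word. (The empty word has $|v|+1$ occurrences in a finite word $v$.) For $n \ge 0$ let $\mathcal{C}_n(w)$ be the number of distinct factors (blocks of consecutive letters) of $w$ of length $n$, and let $\mathcal{A}_n(w)$ be the number of distinct privileged factors of $w$ of length $n$. The word $w$ is \emph{Sturmian} if $\mathcal{C}_n(w) = n+1$ for all $n \ge 0$. \textbf{Theorem.} An infinite word $w$ over $A$ is Sturmian if and only if, for all $n \ge 0$, \[ \mathcal{A}_n(w) = \begin{cases} 1, & \text{if } n \text{ is even},\\ 2, & \text{if } n \text{ is odd}.\end{cases} \] -/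

import Mathlib

namespace PrivilegedWords

/-- The occurrences of the finite word `u` in the finite word `w`: the positions `i`
(counted from `0`) at which a copy of `u` begins in `w`. The empty word occurs at each of the
`|w| + 1` positions `0, …, |w|`. -/
def occurrences {A : Type*} (u w : List A) : Set ℕ :=
  {i | i ≤ w.length ∧ u <+: w.drop i}

/-- `w` is a complete first return to `u`: it starts and ends with `u` and contains exactly two
occurrences of `u`. -/
def IsCompleteFirstReturn {A : Type*} (w u : List A) : Prop :=
  u <+: w ∧ u <:+ w ∧ (occurrences u w).ncard = 2

/-- Privileged words: the empty word, the letters, and every word of length at least two that is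
a complete first return to a shorter privileged word. -/
inductive IsPrivileged {A : Type*} : List A → Prop
  | nil : IsPrivileged []
  | letter (a : A) : IsPrivileged [a]
  | completeReturn (w u : List A) : 2 ≤ w.length → u.length < w.length → IsPrivileged u →
      IsCompleteFirstReturn w u → IsPrivileged w

/-- The finite word `u` is a factor of the infinite word `w`, that is
`u = w i, w (i + 1), …, w (i + |u| - 1)` for some position `i`. -/
def IsFactor {A : Type*} (u : List A) (w : ℕ → A) : Prop :=
  ∃ i : ℕ, u = (List.range u.length).map fun k => w (i + k)

/-- The set of factors of length `n` of the infinite word `w`. -/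
def factors {A : Type*} (w : ℕ → A) (n : ℕ) : Set (List A) :=
  {u | u.length = n ∧ IsFactor u w}

/-- The factor complexity function of `w`: the number of distinct factors of length `n`. -/
noncomputable def factorComplexity {A : Type*} (w : ℕ → A) (n : ℕ) : ℕ :=
  (factors w n).ncard

/-- The privileged complexity function of `w`: the number of distinct privileged factors of
length `n`. -/
noncomputable def privilegedComplexity {A : Type*} (w : ℕ → A) (n : ℕ) : ℕ :=
  {u | u ∈ factors w n ∧ IsPrivileged u}.ncard

/-- An infinite word is Sturmian if it has exactly `n + 1` factors of length `n`, for all `n`. -/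
def IsSturmian {A : Type*} (w : ℕ → A) : Prop :=
  ∀ n : ℕ, factorComplexity w n = n + 1

end PrivilegedWords

/-!
A word with `n + 1` factors of each length has exactly one right special factor of each length.
If `r` is a right special palindrome then, `r` being the only place where a choice is possible, the
first returns to `r` read in either direction agree, so they are palindromes; every other
palindrome is surrounded by forced equal letters until it becomes right special. Hence complete
first returns to palindromes are palindromes, and the privileged factors of a Sturmian word are its
palindromic ones. Removing the outer letters is a bijection from the palindromes of length `n + 2`
to those of length `n`, so there are `1, 2, 1, 2, …` of them.

Conversely, the counts exclude eventual periodicity, because a word of length `n` has at most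
`n + 1` privileged factors. Suppose that there is one right special word of each length up to `m`.
The palindromes of length at most `m + 1` then number `1, 2, 1, 2, …` and, being privileged, exhaust
the privileged factors. Two right special words of length `m + 1` would be `c r` and `d r` with `r`
a palindrome, and `c r c` and `d r d` would be one palindrome too many at length `m + 2`; so there
is again only one.

To allow for a prefix that never returns, all of this is carried out with the words that occur
infinitely often instead of the factors.
-/

namespace PrivilegedWords

open Filter

variable {A : Type*}

section Lists

variable {u v z : List A}

theorem mem_occurrences {p : ℕ} :
    p ∈ occurrences u v ↔ ∃ s t, s ++ u ++ t = v ∧ s.length = p := by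
  constructor
  · rintro ⟨hp, t, ht⟩
    exact ⟨v.take p, t, by rw [List.append_assoc, ht, List.take_append_drop], by simp [hp]⟩
  · rintro ⟨s, t, rfl, rfl⟩
    exact ⟨by simp only [List.length_append]; omega, by simp⟩

theorem finite_occurrences (u v : List A) : (occurrences u v).Finite :=
  (Set.finite_Iic v.length).subset fun _ hp => hp.1

theorem IsCompleteFirstReturn.length_lt (h : IsCompleteFirstReturn v u) :
    u.length < v.length := by
  by_contra! hle
  have hsub : (occurrences u v).Subsingleton := by
    suffices ∀ p ∈ occurrences u v, p = 0 from fun p hp q hq => (this p hp).trans (this q hq).symm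
    intro p hp
    obtain ⟨s, t, rfl, rfl⟩ := mem_occurrences.1 hp
    simp only [List.length_append] at hle
    omega
  have hfin := (finite_occurrences u v).to_subtype
  exact ((Set.ncard_le_one_iff_subsingleton.2 hsub).trans_lt one_lt_two).ne h.2.2

theorem IsCompleteFirstReturn.eq_nil_or_eq_nil (h : IsCompleteFirstReturn v u) {s t : List A}
    (hst : s ++ u ++ t = v) : s = [] ∨ t = [] := by
  by_contra! hne
  obtain ⟨x, hx⟩ := h.1
  obtain ⟨y, hy⟩ := h.2.1
  have hs := List.length_pos_of_ne_nil hne.1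
  have ht := List.length_pos_of_ne_nil hne.2
  have hlen := congrArg List.length (hst.trans hy.symm)
  simp only [List.length_append] at hlen
  have hthree : 2 < (occurrences u v).ncard := (Set.two_lt_ncard_iff (finite_occurrences u v)).2
    ⟨0, s.length, y.length, mem_occurrences.2 ⟨[], x, hx, rfl⟩,
      mem_occurrences.2 ⟨s, t, hst, rfl⟩, mem_occurrences.2 ⟨y, [], by simpa using hy, rfl⟩,
      by omega, by omega, by omega⟩
  exact hthree.ne' h.2.2

theorem isCompleteFirstReturn_iff :
    IsCompleteFirstReturn v u ↔ u.length < v.length ∧ u <+: v ∧ u <:+ v ∧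
      ∀ s t, s ++ u ++ t = v → s = [] ∨ t = [] := by
  refine ⟨fun h => ⟨h.length_lt, h.1, h.2.1, fun s t => h.eq_nil_or_eq_nil⟩, ?_⟩
  rintro ⟨hlt, ⟨x, hx⟩, ⟨y, hy⟩, hends⟩
  have hlen : y.length + u.length = v.length := by rw [← hy, List.length_append]
  have hocc : occurrences u v = {0, y.length} := by
    ext p
    rw [mem_occurrences, Set.mem_insert_iff, Set.mem_singleton_iff]
    constructor
    · rintro ⟨s, t, hst, rfl⟩
      obtain rfl | rfl := hends s t hst
      · exact .inl rfl
      · refine .inr ?_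
        rw [← hst] at hlen
        simpa using hlen.symm
    · rintro (rfl | rfl)
      exacts [⟨[], x, hx, rfl⟩, ⟨y, [], by simpa using hy, rfl⟩]
  exact ⟨⟨x, hx⟩, ⟨y, hy⟩, by rw [hocc, Set.ncard_pair (by omega)]⟩

theorem IsCompleteFirstReturn.isPrivileged (h : IsCompleteFirstReturn v u)
    (hu : IsPrivileged u) : IsPrivileged v := by
  match v, h with
  | [], _ => exact .nil
  | [a], _ => exact .letter a
  | _ :: _ :: _, h => exact .completeReturn _ u (by simp) h.length_lt hu h

theorem IsPrivileged.suffix_of_prefix (hu : IsPrivileged u) (hv : IsPrivileged v)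
    (h : u <+: v) : u <:+ v := by
  induction hn : v.length using Nat.strong_induction_on generalizing u v with
  | _ n ih =>
  subst hn
  obtain heq | hlt := h.length_le.eq_or_lt
  · rw [h.eq_of_length heq]
  cases hv with
  | nil => simp at hlt
  | letter a =>
    rw [List.length_singleton, Nat.lt_one_iff, List.length_eq_zero_iff] at hlt
    exact hlt ▸ List.nil_suffix
  | completeReturn _ x _ hxv hx hret =>
    obtain hux | hxu := le_or_gt u.length x.length
    · exact (ih _ hxv hu hx (List.prefix_of_prefix_length_le h hret.1 hux) rfl).trans hret.2.1
    · obtain ⟨s, rfl⟩ := ih _ hlt hx hu (List.prefix_of_prefix_length_le hret.1 h hxu.le) rfl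
      obtain ⟨t, rfl⟩ := h
      obtain rfl | rfl := hret.eq_nil_or_eq_nil rfl
      · simp at hxu
      · simp at hlt

theorem subsingleton_privileged_prefix_not_infix_tail (a : A) (v : List A) :
    {u | IsPrivileged u ∧ u <+: a :: v ∧ ¬ u <:+: v}.Subsingleton := by
  suffices key : ∀ u u', IsPrivileged u → IsPrivileged u' → u <+: a :: v → u' <+: a :: v →
      ¬ u <:+: v → u.length ≤ u'.length → u = u' by
    rintro u ⟨hu, hpre, hinf⟩ u' ⟨hu', hpre', hinf'⟩
    obtain h | h := le_total u.length u'.length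
    exacts [key u u' hu hu' hpre hpre' hinf h, (key u' u hu' hu hpre' hpre hinf' h).symm]
  intro u u' hu hu' hpre hpre' hinf hle
  have hsuf := hu.suffix_of_prefix hu' (List.prefix_of_prefix_length_le hpre hpre' hle)
  match u', hpre' with
  | [], _ => exact List.suffix_nil.1 hsuf
  | b :: x, hpre' =>
    obtain h | h := List.suffix_cons_iff.1 hsuf
    · exact h
    · exact absurd (h.isInfix.trans (List.cons_prefix_cons.1 hpre').2.isInfix) hinf

theorem encard_privileged_infix_le (v : List A) :
    {u | IsPrivileged u ∧ u <:+: v}.encard ≤ v.length + 1 := by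
  induction v with
  | nil =>
    refine Set.encard_le_one_iff.2 ?_ |>.trans (by simp)
    rintro u u' ⟨-, hu⟩ ⟨-, hu'⟩
    rw [List.infix_nil.1 hu, List.infix_nil.1 hu']
  | cons a v ih =>
    have hsub : {u | IsPrivileged u ∧ u <:+: a :: v} ⊆ {u | IsPrivileged u ∧ u <:+: v} ∪
        {u | IsPrivileged u ∧ u <+: a :: v ∧ ¬ u <:+: v} := by
      rintro u ⟨hu, hinf⟩
      by_cases h : u <:+: v
      · exact .inl ⟨hu, h⟩
      · exact .inr ⟨hu, (List.infix_cons_iff.1 hinf).resolve_right h, h⟩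
    calc _ ≤ _ := (Set.encard_le_encard hsub).trans (Set.encard_union_le _ _)
      _ ≤ (v.length + 1) + 1 := add_le_add ih
        (Set.encard_le_one_iff_subsingleton.2 (subsingleton_privileged_prefix_not_infix_tail a v))
      _ = ((a :: v).length : ℕ∞) + 1 := by rw [List.length_cons, Nat.cast_succ]

theorem exists_isCompleteFirstReturn_suffix (hu : u <:+ z) {s t : List A} (hz : s ++ u ++ t = z)
    (hs : s ≠ []) (ht : t ≠ []) : ∃ v, v <:+ z ∧ v ≠ z ∧ IsCompleteFirstReturn v u := by
  induction hn : t.length using Nat.strong_induction_on generalizing s t with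
  | _ n ih =>
  by_cases hret : IsCompleteFirstReturn (u ++ t) u
  · refine ⟨u ++ t, ⟨s, by rw [← List.append_assoc, hz]⟩, fun h => hs ?_, hret⟩
    simpa [← hz] using h
  · have hsuf : u <:+ u ++ t := List.suffix_of_suffix_length_le hu
      ⟨s, by rw [← List.append_assoc, hz]⟩ (by simp)
    have hlt : u.length < (u ++ t).length := by
      simpa using List.length_pos_of_ne_nil ht
    rw [isCompleteFirstReturn_iff] at hret
    push Not at hret
    obtain ⟨s', t', hst', hs', ht'⟩ := hret hlt (List.prefix_append u t) hsuf
    have hlen := congrArg List.length hst'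
    have := List.length_pos_of_ne_nil hs'
    simp only [List.length_append] at hlen
    refine ih t'.length (by omega) (s := s ++ s') (t := t') ?_ (by simp [hs]) ht' rfl
    rw [← hz, List.append_assoc s u t, ← hst']
    simp only [List.append_assoc]

/-- The longest proper palindromic suffix of a palindrome is also a prefix, and a third occurrence
would produce a longer palindromic suffix. -/
theorem isPrivileged_of_palindrome (hz : z.Palindrome)
    (ih : ∀ u, u <:+ z → u ≠ z → (IsPrivileged u ↔ u.Palindrome)) : IsPrivileged z := by
  classical
  obtain rfl | hne := eq_or_ne z []
  · exact .nil
  have hzpos := List.length_pos_of_ne_nil hne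
  have hex : ∃ k, 0 < k ∧ (z.drop k).Palindrome := ⟨z.length, hzpos, by simpa using .nil⟩
  obtain ⟨k, ⟨hk, hpal⟩, hmin⟩ : ∃ k, (0 < k ∧ (z.drop k).Palindrome) ∧
      ∀ l < k, ¬ (0 < l ∧ (z.drop l).Palindrome) :=
    ⟨Nat.find hex, Nat.find_spec hex, fun l hl => Nat.find_min hex hl⟩
  have hsuf : z.drop k <:+ z := List.drop_suffix k z
  have hpre : z.drop k <+: z := by
    have := List.reverse_prefix.2 hsuf
    rwa [hz.reverse_eq, hpal.reverse_eq] at this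
  have hlt : (z.drop k).length < z.length := by rw [List.length_drop]; omega
  have hpriv : IsPrivileged (z.drop k) := (ih _ hsuf fun h => hlt.ne (by rw [h])).2 hpal
  refine IsCompleteFirstReturn.isPrivileged (isCompleteFirstReturn_iff.2
    ⟨hlt, hpre, hsuf, fun s t hst => ?_⟩) hpriv
  by_contra! hends
  obtain ⟨v, ⟨x, hx⟩, hvz, hret⟩ :=
    exists_isCompleteFirstReturn_suffix hsuf hst hends.1 hends.2
  have hv : v = z.drop x.length := by rw [← hx, List.drop_left]
  have hxpos : 0 < x.length := by
    refine List.length_pos_of_ne_nil fun h => hvz ?_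
    rw [← hx, h, List.nil_append]
  have hlt := hret.length_lt
  rw [hv, List.length_drop, List.length_drop] at hlt
  refine hmin x.length (by omega) ⟨hxpos, ?_⟩
  rw [← hv]
  exact (ih v ⟨x, hx⟩ hvz).1 (hret.isPrivileged hpriv)

theorem IsCompleteFirstReturn.cons_concat (h : IsCompleteFirstReturn v u) {c : A}
    (hc : ∀ a b, a :: (u ++ [b]) <:+: c :: (v ++ [c]) → a = c ∧ b = c) :
    IsCompleteFirstReturn (c :: (v ++ [c])) (c :: (u ++ [c])) := by
  have hlt := h.length_lt
  refine isCompleteFirstReturn_iff.2 ⟨by simpa using hlt, ?_, ?_, fun s t hst => ?_⟩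
  · obtain ⟨x, rfl⟩ := h.1
    match x, hlt with
    | [], hlt => simp at hlt
    | b :: x, _ =>
      have hpre : c :: (u ++ [b]) <+: c :: (u ++ b :: x ++ [c]) := ⟨x ++ [c], by simp⟩
      obtain rfl := (hc c b hpre.isInfix).2
      exact hpre
  · obtain ⟨x, rfl⟩ := h.2.1
    obtain rfl | ⟨x, a, rfl⟩ := List.eq_nil_or_concat' x
    · simp at hlt
    · have hsuf : a :: (u ++ [c]) <:+ c :: (x ++ [a] ++ u ++ [c]) := ⟨c :: x, by simp⟩
      obtain rfl := (hc a c hsuf.isInfix).1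
      exact hsuf
  · by_contra! hne
    obtain ⟨a, s, rfl⟩ := List.exists_cons_of_ne_nil hne.1
    obtain rfl | ⟨t, b, rfl⟩ := List.eq_nil_or_concat' t
    · exact hne.2 rfl
    have hst : (s ++ [c]) ++ u ++ ([c] ++ t) = v := by
      have hdrop := (List.cons.inj hst).2
      rw [List.append_eq, List.append_eq, ← List.append_assoc] at hdrop
      simpa using (List.append_inj' hdrop rfl).1
    simpa using h.eq_nil_or_eq_nil hst

end Lists

section Windows

variable {w : ℕ → A} {u v : List A} {i j n : ℕ}

/-- The factor `w i, …, w (i + n - 1)` of the infinite word `w`. -/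
def window (w : ℕ → A) (i n : ℕ) : List A := (List.range n).map fun k => w (i + k)

@[simp]
theorem length_window : (window w i n).length = n := by simp [window]

@[simp]
theorem getElem_window {k : ℕ} (hk : k < (window w i n).length) :
    (window w i n)[k] = w (i + k) := by simp [window]

theorem window_add (w : ℕ → A) (i m n : ℕ) :
    window w i (m + n) = window w i m ++ window w (i + m) n := by
  simp [window, List.range_add, Function.comp_def, add_assoc]

theorem window_succ (w : ℕ → A) (i n : ℕ) : window w i (n + 1) = window w i n ++ [w (i + n)] := by
  simp [window, List.range_succ]

theorem window_infix_window {m : ℕ} (hij : i ≤ j) (hjm : j + m ≤ i + n) :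
    window w j m <:+: window w i n := by
  obtain ⟨k, rfl⟩ := Nat.exists_eq_add_of_le hij
  obtain ⟨l, rfl⟩ := Nat.exists_eq_add_of_le (show k + m ≤ n by omega)
  rw [window_add, window_add]
  exact ⟨_, _, rfl⟩

theorem window_eq_window_iff {x y : ℕ → A} :
    window x i n = window y j n ↔ ∀ k < n, x (i + k) = y (j + k) := by
  simp [window, List.map_inj_left]

theorem palindrome_window_iff :
    (window w i n).Palindrome ↔ ∀ k < n, w (i + k) = w (i + (n - 1 - k)) := by
  rw [List.Palindrome.iff_reverse_eq, eq_comm, List.ext_getElem_iff]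
  simp

/-- The finite word `u` is read in the infinite word `w` from position `i` on. -/
def OccursAt (w : ℕ → A) (u : List A) (i : ℕ) : Prop := u = window w i u.length

theorem occursAt_iff_getElem :
    OccursAt w u i ↔ ∀ (k : ℕ) (hk : k < u.length), u[k] = w (i + k) := by
  simp [OccursAt, List.ext_getElem_iff]

theorem occursAt_window {x : ℕ → A} :
    OccursAt w (window x i n) j ↔ ∀ k < n, x (i + k) = w (j + k) := by
  rw [OccursAt, length_window, window_eq_window_iff]

theorem occursAt_window_self (w : ℕ → A) (i n : ℕ) : OccursAt w (window w i n) i :=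
  occursAt_window.2 fun _ _ => rfl

theorem OccursAt.window_eq (h : OccursAt w u i) (hn : u.length = n) : window w i n = u :=
  hn ▸ h.symm

theorem occursAt_nil (w : ℕ → A) (i : ℕ) : OccursAt w [] i := rfl

theorem occursAt_append :
    OccursAt w (u ++ v) i ↔ OccursAt w u i ∧ OccursAt w v (i + u.length) := by
  rw [OccursAt, List.length_append, window_add]
  exact ⟨fun h => List.append_inj h (by simp), fun h => congrArg₂ _ h.1 h.2⟩

theorem occursAt_singleton {c : A} : OccursAt w [c] i ↔ c = w i := by
  simp [OccursAt, window]

theorem occursAt_concat {c : A} :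
    OccursAt w (u ++ [c]) i ↔ OccursAt w u i ∧ c = w (i + u.length) := by
  rw [occursAt_append, occursAt_singleton]

theorem occursAt_cons {c : A} :
    OccursAt w (c :: u) i ↔ c = w i ∧ OccursAt w u (i + 1) := by
  rw [← List.singleton_append, occursAt_append, occursAt_singleton, List.length_singleton]

theorem OccursAt.of_mirror (hu : u.Palindrome) (h : OccursAt w u i)
    (hmirror : ∀ k < u.length, w (j + k) = w (i + (u.length - 1 - k))) : OccursAt w u j := by
  rw [← h.window_eq rfl, palindrome_window_iff] at hu
  rw [← h.window_eq rfl, occursAt_window]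
  intro k hk
  rw [hu k hk, hmirror k hk]

/-- Positions `i < j` at which `u` is read in `w`, but nowhere in between. -/
structure IsReturn (w : ℕ → A) (u : List A) (i j : ℕ) : Prop where
  lt : i < j
  left : OccursAt w u i
  right : OccursAt w u j
  not_between : ∀ k, i < k → k < j → ¬ OccursAt w u k

theorem exists_isReturn_straddling {x p y : ℕ} (hx : OccursAt w u x) (hxp : x ≤ p)
    (hpy : p < y) (hy : OccursAt w u y) :
    ∃ i j, x ≤ i ∧ i ≤ p ∧ p < j ∧ j ≤ y ∧ IsReturn w u i j := by
  classical
  have hex : ∃ j, p < j ∧ OccursAt w u j := ⟨y, hpy, hy⟩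
  refine ⟨Nat.findGreatest (OccursAt w u) p, Nat.find hex, Nat.le_findGreatest hxp hx,
    Nat.findGreatest_le p, (Nat.find_spec hex).1, Nat.find_min' hex ⟨hpy, hy⟩,
    (Nat.findGreatest_le p).trans_lt (Nat.find_spec hex).1, Nat.findGreatest_spec hxp hx,
    (Nat.find_spec hex).2, fun k hik hkj hk => ?_⟩
  obtain hkp | hpk := le_or_gt k p
  · exact (Nat.le_findGreatest hkp hk).not_gt hik
  · exact Nat.find_min hex hkj ⟨hpk, hk⟩

theorem eq_window_iff : u = window w i n ↔ u.length = n ∧ OccursAt w u i :=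
  ⟨fun h => have hn : u.length = n := by rw [h, length_window]
    ⟨hn, by rwa [OccursAt, hn]⟩, fun h => h.1 ▸ h.2⟩

theorem isCompleteFirstReturn_window_iff :
    IsCompleteFirstReturn (window w i (n + u.length)) u ↔ IsReturn w u i (i + n) := by
  have hpre : u <+: window w i (n + u.length) ↔ OccursAt w u i := by
    rw [List.prefix_iff_eq_take, add_comm, window_add, List.take_left' length_window]
    rfl
  have hsuf : u <:+ window w i (n + u.length) ↔ OccursAt w u (i + n) := by
    rw [List.suffix_iff_eq_drop, length_window, Nat.add_sub_cancel, window_add,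
      List.drop_left' length_window]
    rfl
  rw [isCompleteFirstReturn_iff, hpre, hsuf, length_window]
  constructor
  · rintro ⟨hlt, hleft, hright, hends⟩
    refine ⟨by omega, hleft, hright, fun k hik hkj hk => ?_⟩
    have hsplit : window w i (k - i) ++ u ++ window w (k + u.length) (i + n - k) =
        window w i (n + u.length) := by
      refine eq_window_iff.2 ⟨by simp; omega, occursAt_append.2 ⟨occursAt_append.2 ⟨?_, ?_⟩, ?_⟩⟩
      · exact occursAt_window_self w i _
      · rwa [length_window, Nat.add_sub_cancel' hik.le]
      · rw [List.length_append, length_window, ← add_assoc, Nat.add_sub_cancel' hik.le]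
        exact occursAt_window_self w _ _
    obtain h | h := hends _ _ hsplit <;> have := congrArg List.length h <;>
      simp only [length_window, List.length_nil] at this <;> omega
  · rintro ⟨hlt, hleft, hright, hbetween⟩
    refine ⟨by omega, hleft, hright, fun s t hst => ?_⟩
    obtain ⟨hlen, hocc⟩ := eq_window_iff.1 hst
    simp only [List.length_append] at hlen
    by_contra! hne
    have hs := List.length_pos_of_ne_nil hne.1
    have ht := List.length_pos_of_ne_nil hne.2
    exact hbetween (i + s.length) (by omega) (by omega)
      (occursAt_append.1 (occursAt_append.1 hocc).1).2

end Windows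

section Recurrence

variable {w : ℕ → A} {u v : List A} {i m n : ℕ} {c d : A}

/-- The finite word `u` occurs infinitely often in the infinite word `w`. -/
def Recurs (w : ℕ → A) (u : List A) : Prop := ∃ᶠ i in atTop, OccursAt w u i

theorem Recurs.exists_ge (h : Recurs w u) (N : ℕ) : ∃ i ≥ N, OccursAt w u i :=
  frequently_atTop.1 h N

theorem Recurs.isFactor (h : Recurs w u) : IsFactor u w := h.exists

theorem Recurs.of_infix (h : Recurs w v) (huv : u <:+: v) : Recurs w u := by
  obtain ⟨s, t, rfl⟩ := huv
  refine frequently_atTop.2 fun N => ?_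
  obtain ⟨i, hi, hocc⟩ := h.exists_ge N
  exact ⟨i + s.length, by omega, (occursAt_append.1 (occursAt_append.1 hocc).1).2⟩

theorem Recurs.left (h : Recurs w (u ++ v)) : Recurs w u :=
  h.of_infix (List.prefix_append u v).isInfix

theorem Recurs.right (h : Recurs w (u ++ v)) : Recurs w v :=
  h.of_infix (List.suffix_append u v).isInfix

theorem Recurs.tail (h : Recurs w (c :: u)) : Recurs w u :=
  h.of_infix (List.suffix_cons c u).isInfix

theorem recurs_nil (w : ℕ → A) : Recurs w [] := .of_forall fun i => occursAt_nil w i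

theorem Recurs.exists_of_mem (h : Recurs w u) (hc : c ∈ u) : ∃ i, w i = c := by
  obtain ⟨s, t, rfl⟩ := List.append_of_mem hc
  obtain ⟨i, hi⟩ := h.exists
  exact ⟨_, (occursAt_cons.1 (occursAt_append.1 hi).2).1.symm⟩

theorem occursAt_shift {N : ℕ} : OccursAt (fun k => w (N + k)) u i ↔ OccursAt w u (N + i) := by
  simp only [occursAt_iff_getElem, add_assoc]

theorem window_shift (w : ℕ → A) (N i n : ℕ) :
    window (fun k => w (N + k)) i n = window w (N + i) n :=
  window_eq_window_iff.2 fun _ _ => by rw [add_assoc]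

theorem recurs_shift (w : ℕ → A) (N : ℕ) : Recurs (fun k => w (N + k)) = Recurs w := by
  funext u
  simp only [Recurs, occursAt_shift, frequently_atTop, eq_iff_iff]
  constructor
  · intro h M
    obtain ⟨i, hi, hocc⟩ := h M
    exact ⟨N + i, by omega, hocc⟩
  · intro h M
    obtain ⟨i, hi, hocc⟩ := h (N + M)
    exact ⟨i - N, by omega, by rwa [Nat.add_sub_cancel' (by omega)]⟩

theorem finite_factors (hw : (Set.range w).Finite) (n : ℕ) : (factors w n).Finite := by
  have := hw.to_subtype
  refine ((List.finite_length_eq (Set.range w) n).image (List.map Subtype.val)).subset ?_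
  rintro u ⟨rfl, i, hi⟩
  refine ⟨(List.range u.length).map fun k => ⟨w (i + k), i + k, rfl⟩, by simp, ?_⟩
  rw [hi]
  simp

theorem window_mem_factors (w : ℕ → A) (i n : ℕ) : window w i n ∈ factors w n :=
  ⟨length_window, i, occursAt_window_self w i n⟩

theorem eventually_recurs_window (hw : (Set.range w).Finite) (n : ℕ) :
    ∀ᶠ i in atTop, Recurs w (window w i n) := by
  have h : ∀ᶠ i in atTop, ∀ u ∈ factors w n, OccursAt w u i → Recurs w u :=
    (Set.Finite.eventually_all (finite_factors hw n)).2 fun u _ => by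
      by_cases hu : Recurs w u
      · exact .of_forall fun _ _ => hu
      · filter_upwards [not_frequently.1 hu] with i hi hocc using absurd hocc hi
  filter_upwards [h] with i hi
  exact hi _ (window_mem_factors w i n) (occursAt_window_self w i n)

theorem Recurs.exists_concat (hw : (Set.range w).Finite) (h : Recurs w u) :
    ∃ c, Recurs w (u ++ [c]) := by
  obtain ⟨i, hocc, hi⟩ := (h.and_eventually (eventually_recurs_window hw (u.length + 1))).exists
  rw [window_succ, hocc.window_eq rfl] at hi
  exact ⟨_, hi⟩

theorem Recurs.exists_cons (hw : (Set.range w).Finite) (h : Recurs w u) :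
    ∃ c, Recurs w (c :: u) := by
  obtain ⟨N, hN⟩ := eventually_atTop.1 (eventually_recurs_window hw (u.length + 1))
  obtain ⟨i, hi, hocc⟩ := h.exists_ge (N + 1)
  obtain ⟨i, rfl⟩ := Nat.exists_eq_succ_of_ne_zero (by omega : i ≠ 0)
  have heq : w i :: u = window w i (u.length + 1) :=
    eq_window_iff.2 ⟨rfl, occursAt_cons.2 ⟨rfl, hocc⟩⟩
  exact ⟨w i, heq ▸ hN i (by omega)⟩

/-- The recurring word `u` has at least two recurring continuations by one letter. -/
def RightSpecial (w : ℕ → A) (u : List A) : Prop :=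
  ∃ c d, c ≠ d ∧ Recurs w (u ++ [c]) ∧ Recurs w (u ++ [d])

theorem RightSpecial.recurs (h : RightSpecial w u) : Recurs w u := by
  obtain ⟨c, d, -, hc, -⟩ := h
  exact hc.left

theorem RightSpecial.of_suffix (h : RightSpecial w v) (huv : u <:+ v) : RightSpecial w u := by
  obtain ⟨s, rfl⟩ := huv
  obtain ⟨c, d, hcd, hc, hd⟩ := h
  rw [List.append_assoc] at hc hd
  exact ⟨c, d, hcd, hc.right, hd.right⟩

theorem eq_of_not_rightSpecial (h : ¬ RightSpecial w u) (hc : Recurs w (u ++ [c]))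
    (hd : Recurs w (u ++ [d])) : c = d := by
  by_contra hcd
  exact h ⟨c, d, hcd, hc, hd⟩

/-- The right special words of length `n` of `w`. -/
def rightSpecials (w : ℕ → A) (n : ℕ) : Set (List A) := {u | u.length = n ∧ RightSpecial w u}

theorem eq_of_forall_not_rightSpecial {x y : ℕ → A} {t : ℕ}
    (hx : ∀ k < t, Recurs w (window x k (m + 1))) (hy : ∀ k < t, Recurs w (window y k (m + 1)))
    (hinit : ∀ k ≤ m, x k = y k) (hns : ∀ k, 0 < k → k < t → ¬ RightSpecial w (window x k m)) :
    ∀ k < m + t, x k = y k := by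
  intro k
  induction k using Nat.strong_induction_on with
  | _ k ih =>
  intro hk
  obtain hkm | hmk := le_or_gt k m
  · exact hinit k hkm
  obtain ⟨s, rfl⟩ := Nat.exists_eq_add_of_lt hmk
  have hs : s + 1 < t := by omega
  have hwin : window x (s + 1) m = window y (s + 1) m :=
    window_eq_window_iff.2 fun l hl => ih _ (by omega) (by omega)
  have hxs := hx _ hs
  have hys := hy _ hs
  rw [window_succ] at hxs hys
  rw [← hwin] at hys
  have := eq_of_not_rightSpecial (hns _ s.succ_pos hs) hxs hys
  rwa [add_comm _ m, ← add_assoc] at this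

/-- From two positions on, `w` continues in the same way. -/
def EventuallyPeriodic (w : ℕ → A) : Prop := ∃ i j, i < j ∧ ∀ k, w (i + k) = w (j + k)

theorem EventuallyPeriodic.exists_bound (h : EventuallyPeriodic w) :
    ∃ B, ∀ i, ∃ j < B, ∀ n, window w i n = window w j n := by
  obtain ⟨p, q, hpq, hper⟩ := h
  refine ⟨q, fun i => ?_⟩
  induction i using Nat.strong_induction_on with
  | _ i ih =>
  obtain hiq | hqi := lt_or_ge i q
  · exact ⟨i, hiq, fun _ => rfl⟩
  · obtain ⟨j, hj, hwin⟩ := ih (i - q + p) (by omega)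
    refine ⟨j, hj, fun n => (window_eq_window_iff.2 fun k _ => ?_).trans (hwin n)⟩
    rw [show i + k = q + (i - q + k) by omega, ← hper]
    congr 1
    omega

theorem rightSpecials_nonempty (hw : (Set.range w).Finite) (hper : ¬ EventuallyPeriodic w)
    (n : ℕ) : (rightSpecials w n).Nonempty := by
  by_contra! hempty
  obtain ⟨N, hN⟩ := eventually_atTop.1 (eventually_recurs_window hw (n + 1))
  obtain ⟨i, j, hij, heq⟩ := Set.Finite.exists_lt_map_eq_of_forall_mem
    (fun i => window_mem_factors w (N + i) (n + 1)) (finite_factors hw (n + 1))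
  refine hper ⟨N + i, N + j, by omega, fun k => ?_⟩
  refine eq_of_forall_not_rightSpecial (w := w) (x := fun k => w (N + i + k))
    (y := fun k => w (N + j + k)) (m := n) (t := k + 1) (fun k _ => ?_) (fun k _ => ?_)
    (fun k hk => ?_) (fun k _ _ h => ?_) k (by omega)
  · exact window_shift w (N + i) k _ ▸ hN _ (by omega)
  · exact window_shift w (N + j) k _ ▸ hN _ (by omega)
  · exact window_eq_window_iff.1 heq k (by omega)
  · exact hempty.subset (⟨length_window, h⟩ : _ ∈ rightSpecials w n)

theorem RightSpecial.exists_cons (hw : (Set.range w).Finite) (hper : ¬ EventuallyPeriodic w)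
    (hunique : (rightSpecials w u.length).Subsingleton) (hu : RightSpecial w u) :
    ∃ c, RightSpecial w (c :: u) := by
  obtain ⟨v, hlen, hv⟩ := rightSpecials_nonempty hw hper (u.length + 1)
  obtain ⟨c, v, rfl⟩ := List.exists_cons_of_length_eq_add_one hlen
  obtain rfl : u = v := hunique ⟨rfl, hu⟩ ⟨by simpa using hlen, hv.of_suffix (v.suffix_cons c)⟩
  exact ⟨c, hv⟩

theorem exists_rightSpecial_append (hrec : ∀ i n, Recurs w (window w i n))
    (hper : ¬ EventuallyPeriodic w) (hu : Recurs w u) : ∃ x, RightSpecial w (u ++ x) := by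
  by_contra! hns
  obtain ⟨i, hi⟩ := hu.exists
  obtain ⟨j, hij, hj⟩ := hu.exists_ge (i + 1)
  have hwin : ∀ n, window w i (u.length + n) = window w j (u.length + n) := by
    intro n
    induction n with
    | zero => exact (hi.window_eq rfl).trans (hj.window_eq rfl).symm
    | succ n ih =>
      have hri := hrec i (u.length + n + 1)
      have hrj := hrec j (u.length + n + 1)
      rw [window_succ, ih] at hri
      rw [window_succ] at hrj
      rw [← add_assoc, window_succ, window_succ, ih, eq_of_not_rightSpecial ?_ hri hrj]
      rw [window_add, hj.window_eq rfl]
      exact hns _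
  exact hper ⟨i, j, hij, fun k => window_eq_window_iff.1 (hwin (k + 1)) k (by omega)⟩

end Recurrence

section Mirror

variable {w : ℕ → A} {m n i j : ℕ}

/-- Two letters of the alphabet suffice to write `w`; they need not both occur. -/
def IsBinary (w : ℕ → A) : Prop := ∃ c d, c ≠ d ∧ ∀ i, w i = c ∨ w i = d

theorem IsBinary.eq_or_eq (hb : IsBinary w) {i j : ℕ} (hij : w i ≠ w j) (k : ℕ) :
    w k = w i ∨ w k = w j := by
  obtain ⟨c, d, -, h⟩ := hb
  grind

theorem IsBinary.finite_range (hb : IsBinary w) : (Set.range w).Finite := by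
  obtain ⟨c, d, -, h⟩ := hb
  exact (Set.toFinite {c, d}).subset (Set.range_subset_iff.2 h)

theorem RightSpecial.recurs_concat {u v : List A} (hb : IsBinary w) (hu : RightSpecial w u)
    {e : A} (hv : Recurs w v) (he : e ∈ v) : Recurs w (u ++ [e]) := by
  obtain ⟨c, d, hcd, hc, hd⟩ := hu
  obtain ⟨i, rfl⟩ := hc.exists_of_mem (List.mem_concat_self)
  obtain ⟨j, rfl⟩ := hd.exists_of_mem (List.mem_concat_self)
  obtain ⟨k, rfl⟩ := hv.exists_of_mem he
  obtain h | h := hb.eq_or_eq hcd k <;> rwa [h]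

/-- The set of recurring words of length `n` is closed under reversal. -/
def ReversalClosed (w : ℕ → A) (n : ℕ) : Prop :=
  ∀ u, u.length = n → Recurs w u → Recurs w u.reverse

/-- The palindromes of length `n` that occur infinitely often in `w`. -/
def recurrentPalindromes (w : ℕ → A) (n : ℕ) : Set (List A) :=
  {u | u.length = n ∧ Recurs w u ∧ u.Palindrome}

/-- Right special words are the only places where `w`, read forwards from `i`, can diverge from
`w`, read backwards from `p`. -/
theorem ReversalClosed.eq_mirror (hrev : ReversalClosed w (m + 1))
    (hrec : ∀ k, Recurs w (window w k (m + 1))) {p t : ℕ} (htp : m + t ≤ p + 1)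
    (hinit : ∀ k ≤ m, w (i + k) = w (p - k))
    (hns : ∀ k, 0 < k → k < t → ¬ RightSpecial w (window w (i + k) m)) :
    ∀ k < m + t, w (i + k) = w (p - k) := by
  refine eq_of_forall_not_rightSpecial (w := w) (x := fun k => w (i + k)) (y := fun k => w (p - k))
    (fun k _ => window_shift w i k _ ▸ hrec _) (fun k hk => ?_) hinit
    (fun k h0 hk => window_shift w i k _ ▸ hns k h0 hk)
  have hback : window (fun k => w (p - k)) k (m + 1) =
      (window w (p - k - m) (m + 1)).reverse := by
    refine List.ext_getElem (by simp) fun l hl _ => ?_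
    rw [length_window] at hl
    simp only [getElem_window, List.getElem_reverse, length_window]
    congr 1
    omega
  exact hback ▸ hrev _ length_window (hrec _)

/-- A palindrome that is the only right special word of its length, at a length where recurring
words are closed under reversal; it is then left special as well. -/
structure BispecialPalindrome (w : ℕ → A) (r : List A) : Prop where
  palindrome : r.Palindrome
  special : RightSpecial w r
  unique : (rightSpecials w r.length).Subsingleton
  closed : ReversalClosed w (r.length + 1)

namespace BispecialPalindrome

variable {r : List A} {i' j' : ℕ} {c d : A}

theorem not_rightSpecial (hr : BispecialPalindrome w r) (h : ¬ OccursAt w r i) :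
    ¬ RightSpecial w (window w i r.length) := fun hs =>
  h (hr.unique ⟨rfl, hr.special⟩ ⟨length_window, hs⟩)

theorem recurs_cons (hr : BispecialPalindrome w r) (h : Recurs w (r ++ [c])) :
    Recurs w (c :: r) := by
  have := hr.closed _ (by simp) h
  rwa [List.reverse_append, hr.palindrome.reverse_eq] at this

theorem last_letter_eq (hr : BispecialPalindrome w r)
    (hrec : ∀ k, Recurs w (window w k (r.length + 1))) (h : IsReturn w r i j)
    (h' : IsReturn w r i' j') (hnext : w (i + r.length) = w (i' + r.length)) :
    w (j - 1) = w (j' - 1) := by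
  wlog hle : j - i ≤ j' - i' generalizing i j i' j'
  · exact (this h' h hnext.symm (by omega)).symm
  have hlt := h.lt
  have hlt' := h'.lt
  have hinit : ∀ k ≤ r.length, w (i + k) = w (i' + k) := by
    intro k hk
    obtain hk | rfl := hk.lt_or_eq
    · exact window_eq_window_iff.1 (h.left.symm.trans h'.left) k hk
    · exact hnext
  have hagree : ∀ k < r.length + (j - i), w (i + k) = w (i' + k) :=
    eq_of_forall_not_rightSpecial (w := w) (x := fun k => w (i + k)) (y := fun k => w (i' + k))
      (fun k _ => window_shift w i k _ ▸ hrec _) (fun k _ => window_shift w i' k _ ▸ hrec _) hinit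
      fun k h0 hk => window_shift w i k _ ▸
        hr.not_rightSpecial (h.not_between _ (by omega) (by omega))
  have hocc : OccursAt w r (i' + (j - i)) := by
    rw [← h.right.window_eq rfl, occursAt_window]
    intro k hk
    have := hagree (j - i + k) (by omega)
    rwa [← add_assoc, ← add_assoc, Nat.add_sub_cancel' hlt.le] at this
  have hlen : j - i = j' - i' := by
    by_contra hne
    exact h'.not_between _ (by omega) (by omega) hocc
  have := hagree (j - i - 1) (by omega)
  rwa [show i + (j - i - 1) = j - 1 by omega, show i' + (j - i - 1) = j' - 1 by omega] at this

theorem exists_isReturn_centred (hr : BispecialPalindrome w r)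
    (hrec : ∀ k, Recurs w (window w k (r.length + 1)))
    (hpal : (recurrentPalindromes w (r.length + 1)).Nonempty) :
    ∃ i j, IsReturn w r i j ∧ w (i + r.length) = w (j - 1) := by
  obtain ⟨z, hzlen, hz, hzpal⟩ := hpal
  obtain ⟨x, hx⟩ := hr.special.recurs.exists
  obtain ⟨p, hxp, hp⟩ := hz.exists_ge x
  obtain ⟨y, hpy, hy⟩ := hr.special.recurs.exists_ge (p + 1)
  obtain ⟨i, j, -, hip, hpj, -, h⟩ := exists_isReturn_straddling hx hxp hpy hy
  have hns : ∀ k, i < k → k < j → ¬ RightSpecial w (window w k r.length) :=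
    fun k hik hkj => hr.not_rightSpecial (h.not_between k hik hkj)
  have hcentre : ∀ k ≤ r.length, w (p + k) = w (p + r.length - k) := by
    intro k hk
    rw [← hp.window_eq hzlen, palindrome_window_iff] at hzpal
    rw [hzpal k (by omega)]
    congr 1
    omega
  have hmirror : ∀ t, t ≤ p - i → t ≤ j - p - 1 → ∀ k < r.length + (t + 1),
      w (p + k) = w (p + r.length - k) := fun t hi hj =>
    hr.closed.eq_mirror hrec (by omega) hcentre fun k h0 hk => hns _ (by omega) (by omega)
  -- The mirror image of the nearer end of the return is another occurrence of `r`.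
  have hbalanced : p - i = j - p - 1 := by
    obtain hlt | heq | hgt := lt_trichotomy (p - i) (j - p - 1)
    · refine absurd (h.left.of_mirror (j := p + (p - i) + 1) hr.palindrome fun k hk => ?_)
        (h.not_between _ (by omega) (by omega))
      have := hmirror (p - i) le_rfl hlt.le (p - i + 1 + k) (by omega)
      rw [show p + (p - i) + 1 + k = p + (p - i + 1 + k) by omega, this]
      congr 1
      omega
    · exact heq
    · refine absurd (h.right.of_mirror (j := p - (j - p - 1)) hr.palindrome fun k hk => ?_)
        (h.not_between _ (by omega) (by omega))
      have := hmirror (j - p - 1) hgt.le le_rfl (j - p + (r.length - 1 - k)) (by omega)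
      rw [show j + (r.length - 1 - k) = p + (j - p + (r.length - 1 - k)) by omega, this]
      congr 1
      omega
  refine ⟨i, j, h, ?_⟩
  have := hmirror (p - i) le_rfl hbalanced.le (p - i) (by omega)
  rw [show j - 1 = p + (p - i) by omega, this]
  congr 1
  omega

theorem next_letter_eq_last_letter (hr : BispecialPalindrome w r) (hb : IsBinary w)
    (hrec : ∀ k, Recurs w (window w k (r.length + 1)))
    (hpal : (recurrentPalindromes w (r.length + 1)).Nonempty) (h : IsReturn w r i j) :
    w (i + r.length) = w (j - 1) := by
  obtain ⟨i₀, j₀, h₀, hcentred⟩ := hr.exists_isReturn_centred hrec hpal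
  by_contra hne
  have hne₀ : w (i + r.length) ≠ w (i₀ + r.length) := fun heq =>
    hne (by rw [heq, hcentred, hr.last_letter_eq hrec h h₀ heq])
  have hlast : w (j - 1) = w (i₀ + r.length) :=
    (hb.eq_or_eq hne₀ _).resolve_left (Ne.symm hne)
  have hnext : Recurs w (r ++ [w (i + r.length)]) := by
    have := hrec i
    rwa [window_succ, h.left.window_eq rfl] at this
  obtain ⟨x, hx⟩ := hr.special.recurs.exists
  obtain ⟨y, hxy, hy⟩ := (hr.recurs_cons hnext).exists_ge x
  obtain ⟨hletter, hy⟩ := occursAt_cons.1 hy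
  obtain ⟨i', j', -, -, hyj, hjy, h'⟩ := exists_isReturn_straddling hx hxy y.lt_succ_self hy
  obtain rfl : j' = y + 1 := by omega
  refine hne₀ (hletter.trans ?_)
  obtain heq | heq := hb.eq_or_eq hne₀ (i' + r.length)
  · exact (hr.last_letter_eq hrec h' h heq).trans hlast
  · exact (hr.last_letter_eq hrec h' h₀ heq).trans hcentred.symm

theorem palindrome_of_isReturn (hr : BispecialPalindrome w r) (hb : IsBinary w)
    (hrec : ∀ k, Recurs w (window w k (r.length + 1)))
    (hpal : (recurrentPalindromes w (r.length + 1)).Nonempty) (h : IsReturn w r i j) :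
    (window w i (j - i + r.length)).Palindrome := by
  have hlt := h.lt
  have hrpal := hr.palindrome
  rw [← h.right.window_eq rfl, palindrome_window_iff] at hrpal
  have hinit : ∀ k ≤ r.length, w (i + k) = w (j + r.length - 1 - k) := by
    intro k hk
    obtain hk | rfl := hk.lt_or_eq
    · rw [window_eq_window_iff.1 (h.left.symm.trans h.right) k hk, hrpal k hk]
      congr 1
      omega
    · rw [hr.next_letter_eq_last_letter hb hrec hpal h]
      congr 1
      omega
  rw [palindrome_window_iff]
  intro k hk
  rw [hr.closed.eq_mirror hrec (t := j - i) (by omega) hinit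
    (fun l h0 hl => hr.not_rightSpecial (h.not_between _ (by omega) (by omega))) k (by omega)]
  congr 1
  omega

theorem recurs_mixed_of_recurs_window (hr : BispecialPalindrome w r) (hb : IsBinary w)
    (hrec : ∀ k, Recurs w (window w k (r.length + 1)))
    (hpal : (recurrentPalindromes w (r.length + 1)).Nonempty) (hcd : c ≠ d)
    (hc : Recurs w (r ++ [c])) (hd : Recurs w (r ++ [d])) : Recurs w (c :: (r ++ [d])) := by
  classical
  refine frequently_atTop.2 fun N => ?_
  obtain ⟨i, hNi, hi⟩ := hc.exists_ge N
  have hex : ∃ j, i < j ∧ OccursAt w (r ++ [d]) j := hd.exists_ge (i + 1)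
  obtain ⟨j, ⟨hij, hj⟩, hfirst⟩ : ∃ j, (i < j ∧ OccursAt w (r ++ [d]) j) ∧
      ∀ k < j, ¬ (i < k ∧ OccursAt w (r ++ [d]) k) :=
    ⟨Nat.find hex, Nat.find_spec hex, fun k hk => Nat.find_min hex hk⟩
  obtain ⟨k, j', hik, hkj, hj1, hjj, h⟩ := exists_isReturn_straddling (p := j - 1)
    (occursAt_concat.1 hi).1 (by omega) (by omega) (occursAt_concat.1 hj).1
  obtain rfl : j' = j := by omega
  have hnext : w (k + r.length) = c := by
    obtain rfl | hik := hik.eq_or_lt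
    · exact (occursAt_concat.1 hi).2.symm
    have hne : w (k + r.length) ≠ d := fun heq =>
      hfirst k h.lt ⟨hik, occursAt_concat.2 ⟨h.left, heq.symm⟩⟩
    rw [(occursAt_concat.1 hi).2, (occursAt_concat.1 hj).2] at hcd
    rw [(occursAt_concat.1 hi).2]
    rw [(occursAt_concat.1 hj).2] at hne
    exact (hb.eq_or_eq hcd _).resolve_right hne
  refine ⟨j' - 1, by omega, occursAt_cons.2 ⟨?_, ?_⟩⟩
  · rw [← hnext, hr.next_letter_eq_last_letter hb hrec hpal h]
  · rwa [Nat.sub_add_cancel (by omega)]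

theorem recurs_mixed (hr : BispecialPalindrome w r) (hb : IsBinary w)
    (hpal : (recurrentPalindromes w (r.length + 1)).Nonempty) (hcd : c ≠ d)
    (hc : Recurs w (r ++ [c])) (hd : Recurs w (r ++ [d])) : Recurs w (c :: (r ++ [d])) := by
  obtain ⟨N, hN⟩ := eventually_atTop.1 (eventually_recurs_window hb.finite_range (r.length + 1))
  have hb' : IsBinary fun k => w (N + k) := by
    obtain ⟨a, b, hab, h⟩ := hb
    exact ⟨a, b, hab, fun i => h _⟩
  obtain ⟨hrpal, hspecial, hunique, hclosed⟩ := hr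
  simp only [RightSpecial, rightSpecials, ReversalClosed, recurrentPalindromes, ← recurs_shift w N]
    at hspecial hunique hclosed hpal hc hd ⊢
  exact recurs_mixed_of_recurs_window ⟨hrpal, hspecial, hunique, hclosed⟩ hb'
    (fun k => recurs_shift w N ▸ window_shift w N k _ ▸ hN _ (by omega)) hpal hcd hc hd

end BispecialPalindrome

end Mirror

section PalindromicStructure

variable {w : ℕ → A} {m : ℕ}

theorem finite_recurrentPalindromes (hw : (Set.range w).Finite) (n : ℕ) :
    (recurrentPalindromes w n).Finite :=
  (finite_factors hw n).subset fun _ hu => ⟨hu.1, hu.2.1.isFactor⟩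

theorem cons_concat_mem_recurrentPalindromes {q : List A} {c : A} (hq : q.Palindrome)
    (h : Recurs w (c :: (q ++ [c]))) (hlen : q.length = m) :
    c :: (q ++ [c]) ∈ recurrentPalindromes w (m + 2) :=
  ⟨by simp [hlen], h, hq.cons_concat c⟩

theorem exists_eq_cons_concat_of_mem_recurrentPalindromes {z : List A}
    (hz : z ∈ recurrentPalindromes w (m + 2)) :
    ∃ c q, z = c :: (q ++ [c]) ∧ q ∈ recurrentPalindromes w m := by
  obtain ⟨hlen, hrec, hpal⟩ := hz
  cases hpal with
  | nil => simp at hlen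
  | singleton c => simp at hlen
  | cons_concat c hq => exact ⟨c, _, rfl, by simpa using hlen, hrec.tail.left, hq⟩

theorem exists_palindromic_extension (hb : IsBinary w) (hper : ¬ EventuallyPeriodic w)
    (hunique : (rightSpecials w m).Subsingleton) (hclosed : ReversalClosed w (m + 1))
    {q : List A} (hq : q ∈ recurrentPalindromes w m) : ∃ c, Recurs w (c :: (q ++ [c])) := by
  obtain ⟨hlen, hrec, hpal⟩ := hq
  by_cases hs : RightSpecial w q
  · obtain ⟨c, hc⟩ := hs.exists_cons hb.finite_range hper (hlen ▸ hunique)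
    exact ⟨c, hc.recurs_concat hb hc.recurs List.mem_cons_self⟩
  · obtain ⟨c, hc⟩ := hrec.exists_concat hb.finite_range
    obtain ⟨d, hd⟩ := hc.exists_cons hb.finite_range
    have hqd := hclosed _ (by simp [hlen]) (hd.left (u := d :: q) (v := [c]))
    rw [List.reverse_cons, hpal.reverse_eq] at hqd
    obtain rfl := eq_of_not_rightSpecial hs hqd hc
    exact ⟨d, hd⟩

theorem tail_dropLast_image_recurrentPalindromes (hb : IsBinary w)
    (hper : ¬ EventuallyPeriodic w) (hunique : (rightSpecials w m).Subsingleton)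
    (hclosed : ReversalClosed w (m + 1)) :
    (fun z => z.tail.dropLast) '' recurrentPalindromes w (m + 2) = recurrentPalindromes w m := by
  ext q
  constructor
  · rintro ⟨z, hz, rfl⟩
    obtain ⟨c, q, rfl, hq⟩ := exists_eq_cons_concat_of_mem_recurrentPalindromes hz
    simpa using hq
  · intro hq
    obtain ⟨c, hc⟩ := exists_palindromic_extension hb hper hunique hclosed hq
    exact ⟨_, cons_concat_mem_recurrentPalindromes hq.2.2 hc hq.1, by simp⟩

theorem bispecialPalindrome_of_rightSpecial_reverse {v : List A} (hlen : v.length = m)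
    (hunique : (rightSpecials w m).Subsingleton) (hclosed : ReversalClosed w (m + 1))
    (hv : RightSpecial w v) (hv' : RightSpecial w v.reverse) : BispecialPalindrome w v where
  palindrome := .of_reverse_eq (hunique ⟨by simpa using hlen, hv'⟩ ⟨hlen, hv⟩)
  special := hv
  unique := hlen ▸ hunique
  closed := hlen ▸ hclosed

theorem ReversalClosed.succ (hb : IsBinary w) (hunique : (rightSpecials w m).Subsingleton)
    (hclosed : ReversalClosed w (m + 1)) (hpal : (recurrentPalindromes w (m + 1)).Nonempty) :
    ReversalClosed w (m + 2) := by
  intro u hu hrec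
  obtain ⟨x, u, rfl⟩ := List.exists_cons_of_length_eq_add_one hu
  obtain rfl | ⟨v, y, rfl⟩ := List.eq_nil_or_concat' u
  · simp at hu
  have hlen : v.length = m := by simpa using hu
  have hx : Recurs w (v.reverse ++ [x]) := by
    simpa using hclosed _ (by simp [hlen]) (hrec.left (u := x :: v))
  have hy : Recurs w (y :: v.reverse) := by
    simpa using hclosed _ (by simp [hlen]) hrec.tail
  suffices Recurs w (y :: (v.reverse ++ [x])) by simpa using this
  by_cases hv' : RightSpecial w v.reverse
  · by_cases hv : RightSpecial w v
    · have hbi := bispecialPalindrome_of_rightSpecial_reverse hlen hunique hclosed hv hv'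
      rw [hbi.palindrome.reverse_eq] at hx ⊢
      obtain rfl | hxy := eq_or_ne x y
      · exact hrec
      · exact hbi.recurs_mixed hb (hlen ▸ hpal) hxy.symm hrec.tail hx
    · obtain ⟨c, hc⟩ := hx.exists_cons hb.finite_range
      have hvc : Recurs w (v ++ [c]) := by
        simpa using hclosed _ (by simp [hlen]) (hc.left (u := c :: v.reverse))
      rwa [← eq_of_not_rightSpecial hv hvc hrec.tail]
  · obtain ⟨c, hc⟩ := hy.exists_concat hb.finite_range
    rwa [← eq_of_not_rightSpecial hv' hc.tail hx]

theorem injOn_tail_dropLast_recurrentPalindromes (hb : IsBinary w)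
    (hunique : (rightSpecials w m).Subsingleton) (hunique' : (rightSpecials w (m + 1)).Subsingleton)
    (hclosed : ReversalClosed w (m + 1)) (hpal : (recurrentPalindromes w (m + 1)).Nonempty) :
    Set.InjOn (fun z => z.tail.dropLast) (recurrentPalindromes w (m + 2)) := by
  intro z hz z' hz' heq
  obtain ⟨c, r, rfl, hr⟩ := exists_eq_cons_concat_of_mem_recurrentPalindromes hz
  obtain ⟨d, r', rfl, -⟩ := exists_eq_cons_concat_of_mem_recurrentPalindromes hz'
  obtain rfl : r = r' := by simpa using heq
  by_contra hne
  have hcd : c ≠ d := fun h => hne (by rw [h])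
  obtain ⟨hlen, -, hrpal⟩ := hr
  have hs : RightSpecial w r := ⟨c, d, hcd, hz.2.1.tail, hz'.2.1.tail⟩
  have hbi := bispecialPalindrome_of_rightSpecial_reverse hlen hunique hclosed hs
    (hrpal.reverse_eq.symm ▸ hs)
  have hmixed := hbi.recurs_mixed hb (hlen ▸ hpal) hcd hz.2.1.tail hz'.2.1.tail
  have hmixed' := hbi.recurs_mixed hb (hlen ▸ hpal) hcd.symm hz'.2.1.tail hz.2.1.tail
  exact hcd (List.cons.inj (hunique' ⟨by simp [hlen], c, d, hcd, hz.2.1, hmixed⟩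
    ⟨by simp [hlen], c, d, hcd, hmixed', hz'.2.1⟩)).1

theorem recurrentPalindromes_zero (w : ℕ → A) : recurrentPalindromes w 0 = {[]} := by
  ext u
  rw [recurrentPalindromes, Set.mem_ofPred_eq, List.length_eq_zero_iff, Set.mem_singleton_iff]
  exact ⟨fun h => h.1, fun h => ⟨h, h ▸ recurs_nil w, h ▸ .nil⟩⟩

theorem ncard_recurrentPalindromes_one (hb : IsBinary w) (hper : ¬ EventuallyPeriodic w) :
    (recurrentPalindromes w 1).ncard = 2 := by
  obtain ⟨u, hu, hs⟩ := rightSpecials_nonempty hb.finite_range hper 0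
  obtain rfl := List.length_eq_zero_iff.1 hu
  obtain ⟨c, d, hcd, hc, hd⟩ := hs
  refine Set.ncard_eq_two.2 ⟨[c], [d], by simpa using hcd, Set.ext fun u => ⟨?_, ?_⟩⟩
  · rintro ⟨hu, hrec, -⟩
    obtain ⟨e, rfl⟩ := List.length_eq_one_iff.1 hu
    obtain ⟨i, rfl⟩ := hc.exists_of_mem (List.mem_singleton_self c)
    obtain ⟨j, rfl⟩ := hd.exists_of_mem (List.mem_singleton_self d)
    obtain ⟨k, rfl⟩ := hrec.exists_of_mem (List.mem_singleton_self e)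
    simpa using hb.eq_or_eq hcd k
  · rintro (rfl | rfl)
    exacts [⟨rfl, hc, .singleton c⟩, ⟨rfl, hd, .singleton d⟩]

theorem reversalClosed_and_ncard_recurrentPalindromes (hb : IsBinary w)
    (hper : ¬ EventuallyPeriodic w) {M : ℕ} (hunique : ∀ n < M, (rightSpecials w n).Subsingleton) :
    ReversalClosed w M ∧ (recurrentPalindromes w M).ncard = if Even M then 1 else 2 := by
  induction M using Nat.twoStepInduction with
  | zero =>
    refine ⟨fun u hu h => ?_, by simp [recurrentPalindromes_zero]⟩
    rwa [List.length_eq_zero_iff.1 hu] at h ⊢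
  | one =>
    refine ⟨fun u hu h => ?_, by simp [ncard_recurrentPalindromes_one hb hper]⟩
    obtain ⟨c, rfl⟩ := List.length_eq_one_iff.1 hu
    exact h
  | more m ih₀ ih₁ =>
    obtain ⟨hclosed, hcard₁⟩ := ih₁ fun n hn => hunique n (by omega)
    obtain ⟨-, hcard₀⟩ := ih₀ fun n hn => hunique n (by omega)
    have hm := hunique m (by omega)
    have hpal : (recurrentPalindromes w (m + 1)).Nonempty :=
      Set.nonempty_of_ncard_ne_zero (by rw [hcard₁]; split_ifs <;> decide)
    refine ⟨hclosed.succ hb hm hpal, ?_⟩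
    rw [← (injOn_tail_dropLast_recurrentPalindromes hb hm (hunique _ (by omega)) hclosed
      hpal).ncard_image, tail_dropLast_image_recurrentPalindromes hb hper hm hclosed, hcard₀]
    simp [Nat.even_add]

theorem subsingleton_rightSpecials_succ (hb : IsBinary w) (hper : ¬ EventuallyPeriodic w)
    (hunique : (rightSpecials w m).Subsingleton) (hclosed : ReversalClosed w (m + 1))
    (hcard : (recurrentPalindromes w (m + 2)).ncard ≤ (recurrentPalindromes w m).ncard) :
    (rightSpecials w (m + 1)).Subsingleton := by
  rintro u ⟨hu, hus⟩ u' ⟨hu', hus'⟩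
  obtain ⟨c, r, rfl⟩ := List.exists_cons_of_length_eq_add_one hu
  obtain ⟨d, r', rfl⟩ := List.exists_cons_of_length_eq_add_one hu'
  have hlen : r.length = m := by simpa using hu
  have hs : RightSpecial w r := hus.of_suffix (r.suffix_cons c)
  obtain rfl : r = r' :=
    hunique ⟨hlen, hs⟩ ⟨by simpa using hu', hus'.of_suffix (r'.suffix_cons d)⟩
  by_contra hne
  have hcd : c ≠ d := fun h => hne (by rw [h])
  have hcr := hclosed _ hu hus.recurs
  have hdr := hclosed _ hu' hus'.recurs
  rw [List.reverse_cons] at hcr hdr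
  have hpal : r.Palindrome := (bispecialPalindrome_of_rightSpecial_reverse hlen hunique hclosed hs
    ⟨c, d, hcd, hcr, hdr⟩).palindrome
  have hfin := finite_recurrentPalindromes hb.finite_range (m + 2)
  have hinj : Set.InjOn (fun z => z.tail.dropLast) (recurrentPalindromes w (m + 2)) := by
    rw [← Set.ncard_image_iff hfin]
    refine (Set.ncard_image_le hfin).antisymm ?_
    rwa [tail_dropLast_image_recurrentPalindromes hb hper hunique hclosed]
  have heq := hinj
    (cons_concat_mem_recurrentPalindromes hpal
      (hus.recurs_concat hb hus.recurs List.mem_cons_self) hlen)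
    (cons_concat_mem_recurrentPalindromes hpal
      (hus'.recurs_concat hb hus'.recurs List.mem_cons_self) hlen) (by simp)
  exact hcd (List.cons.inj heq).1

end PalindromicStructure

section Complexity

variable {w : ℕ → A} {u v : List A} {m n : ℕ}

/-- The words of length `n` that occur infinitely often in `w`. -/
def recurrentWords (w : ℕ → A) (n : ℕ) : Set (List A) := {u | u.length = n ∧ Recurs w u}

/-- The words of length `n` that recur in `w` when followed by the letter `c`. -/
def recurrentStems (w : ℕ → A) (c : A) (n : ℕ) : Set (List A) :=
  {u | u.length = n ∧ Recurs w (u ++ [c])}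

theorem recurrentWords_subset_factors (w : ℕ → A) (n : ℕ) : recurrentWords w n ⊆ factors w n :=
  fun _ hu => ⟨hu.1, hu.2.isFactor⟩

theorem recurrentWords_eq_factors (h : ∀ u, IsFactor u w → Recurs w u) (n : ℕ) :
    recurrentWords w n = factors w n :=
  (recurrentWords_subset_factors w n).antisymm fun u hu => ⟨hu.1, h u hu.2⟩

theorem ncard_recurrentWords_zero (w : ℕ → A) : (recurrentWords w 0).ncard = 1 :=
  Set.ncard_eq_one.2 ⟨[], Set.ext fun _ =>
    ⟨fun h => List.length_eq_zero_iff.1 h.1, fun h => h ▸ ⟨rfl, recurs_nil w⟩⟩⟩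

theorem finite_rightSpecials (hw : (Set.range w).Finite) (n : ℕ) : (rightSpecials w n).Finite :=
  (finite_factors hw n).subset fun _ hu => ⟨hu.1, hu.2.recurs.isFactor⟩

theorem finite_recurrentStems (hw : (Set.range w).Finite) (c : A) (n : ℕ) :
    (recurrentStems w c n).Finite :=
  (finite_factors hw n).subset fun _ hu => ⟨hu.1, hu.2.left.isFactor⟩

theorem recurrentStems_union {c d : A} (hw : (Set.range w).Finite)
    (hcd : ∀ i, w i = c ∨ w i = d) :
    recurrentStems w c n ∪ recurrentStems w d n = recurrentWords w n := by
  ext u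
  constructor
  · rintro (h | h) <;> exact ⟨h.1, h.2.left⟩
  · rintro ⟨hlen, hu⟩
    obtain ⟨e, he⟩ := hu.exists_concat hw
    obtain ⟨i, rfl⟩ := he.exists_of_mem List.mem_concat_self
    obtain h | h := hcd i
    · exact .inl ⟨hlen, h ▸ he⟩
    · exact .inr ⟨hlen, h ▸ he⟩

theorem recurrentStems_inter {c d : A} (hne : c ≠ d) (hcd : ∀ i, w i = c ∨ w i = d) :
    recurrentStems w c n ∩ recurrentStems w d n = rightSpecials w n := by
  ext u
  constructor
  · exact fun h => ⟨h.1.1, c, d, hne, h.1.2, h.2.2⟩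
  · rintro ⟨hlen, a, b, hab, ha, hb⟩
    obtain ⟨i, rfl⟩ := ha.exists_of_mem List.mem_concat_self
    obtain ⟨j, rfl⟩ := hb.exists_of_mem List.mem_concat_self
    obtain ⟨hi, hj⟩ | ⟨hi, hj⟩ : w i = c ∧ w j = d ∨ w i = d ∧ w j = c := by grind
    · exact ⟨⟨hlen, hi ▸ ha⟩, hlen, hj ▸ hb⟩
    · exact ⟨⟨hlen, hj ▸ hb⟩, hlen, hi ▸ ha⟩

theorem image_concat_recurrentStems_union {c d : A} (hcd : ∀ i, w i = c ∨ w i = d) :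
    (· ++ [c]) '' recurrentStems w c n ∪ (· ++ [d]) '' recurrentStems w d n =
      recurrentWords w (n + 1) := by
  ext u
  constructor
  · rintro (⟨v, hv, rfl⟩ | ⟨v, hv, rfl⟩) <;> exact ⟨by simp [hv.1], hv.2⟩
  · rintro ⟨hlen, hu⟩
    obtain rfl | ⟨v, e, rfl⟩ := List.eq_nil_or_concat' u
    · simp at hlen
    have hv : v.length = n := by simpa using hlen
    obtain ⟨i, rfl⟩ := hu.exists_of_mem List.mem_concat_self
    obtain h | h := hcd i
    · exact .inl ⟨v, ⟨hv, h ▸ hu⟩, by rw [h]⟩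
    · exact .inr ⟨v, ⟨hv, h ▸ hu⟩, by rw [h]⟩

theorem ncard_recurrentWords_succ (hb : IsBinary w) (n : ℕ) :
    (recurrentWords w (n + 1)).ncard = (recurrentWords w n).ncard + (rightSpecials w n).ncard := by
  have hw := hb.finite_range
  obtain ⟨c, d, hne, hcd⟩ := hb
  have hfin := fun e => finite_recurrentStems hw e n
  have hdisj : Disjoint ((· ++ [c]) '' recurrentStems w c n)
      ((· ++ [d]) '' recurrentStems w d n) := by
    rw [Set.disjoint_left]
    rintro _ ⟨u, -, rfl⟩ ⟨v, -, h⟩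
    exact hne (List.cons.inj (List.append_inj' h rfl).2).1.symm
  rw [← image_concat_recurrentStems_union hcd,
    Set.ncard_union_eq hdisj ((hfin c).image _) ((hfin d).image _),
    Set.ncard_image_of_injective _ (List.append_left_injective _),
    Set.ncard_image_of_injective _ (List.append_left_injective _),
    ← recurrentStems_union hw hcd, ← recurrentStems_inter hne hcd,
    Set.ncard_union_add_ncard_inter _ _ (hfin c) (hfin d)]

theorem isBinary_of_ncard_factors_one (h : (factors w 1).ncard = 2) : IsBinary w := by
  obtain ⟨u, v, huv, hfac⟩ := Set.ncard_eq_two.1 h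
  have hu : u ∈ factors w 1 := hfac ▸ .inl rfl
  have hv : v ∈ factors w 1 := hfac ▸ .inr rfl
  obtain ⟨c, rfl⟩ := List.length_eq_one_iff.1 hu.1
  obtain ⟨d, rfl⟩ := List.length_eq_one_iff.1 hv.1
  refine ⟨c, d, fun h => huv (by rw [h]), fun i => ?_⟩
  have : [w i] ∈ factors w 1 := window_mem_factors w i 1
  simpa [hfac] using this

theorem lt_ncard_recurrentWords (hb : IsBinary w) (hper : ¬ EventuallyPeriodic w) (n : ℕ) :
    n < (recurrentWords w n).ncard := by
  induction n with
  | zero => simp [ncard_recurrentWords_zero]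
  | succ n ih =>
    have := (Set.ncard_pos (finite_rightSpecials hb.finite_range n)).2
      (rightSpecials_nonempty hb.finite_range hper n)
    rw [ncard_recurrentWords_succ hb]
    omega

end Complexity

section SturmianWords

variable {w : ℕ → A} {u v : List A} {n : ℕ}

namespace IsSturmian

theorem isBinary (h : IsSturmian w) : IsBinary w := isBinary_of_ncard_factors_one (h 1)

theorem not_eventuallyPeriodic (h : IsSturmian w) : ¬ EventuallyPeriodic w := by
  intro hper
  obtain ⟨B, hB⟩ := hper.exists_bound
  have hsub : factors w B ⊆ (fun i => window w i B) '' Set.Iio B := by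
    rintro u ⟨hlen, i, hi⟩
    obtain ⟨j, hj, hwin⟩ := hB i
    exact ⟨j, hj, (hwin B).symm.trans (OccursAt.window_eq hi hlen)⟩
  have hcard := (Set.ncard_le_ncard hsub ((Set.finite_Iio B).image _)).trans
    (Set.ncard_image_le (Set.finite_Iio B))
  rw [Set.ncard_Iio_nat] at hcard
  have : (factors w B).ncard = B + 1 := h B
  omega

theorem recurs_of_isFactor (h : IsSturmian w) (hu : IsFactor u w) : Recurs w u := by
  have heq : recurrentWords w u.length = factors w u.length := by
    refine Set.eq_of_subset_of_ncard_le (recurrentWords_subset_factors w _) ?_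
      (finite_factors h.isBinary.finite_range _)
    exact (h u.length).le.trans (lt_ncard_recurrentWords h.isBinary h.not_eventuallyPeriodic _)
  exact (heq.superset ⟨rfl, hu⟩).2

theorem subsingleton_rightSpecials (h : IsSturmian w) (n : ℕ) :
    (rightSpecials w n).Subsingleton := by
  have hcount : ∀ k, (recurrentWords w k).ncard = k + 1 := fun k =>
    (congrArg _ (recurrentWords_eq_factors (fun _ => h.recurs_of_isFactor) k)).trans (h k)
  have hcard := ncard_recurrentWords_succ h.isBinary n
  rw [hcount, hcount] at hcard
  have := (finite_rightSpecials h.isBinary.finite_range n).to_subtype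
  exact Set.ncard_le_one_iff_subsingleton.1 (by omega)

theorem reversalClosed (h : IsSturmian w) (n : ℕ) : ReversalClosed w n :=
  (reversalClosed_and_ncard_recurrentPalindromes h.isBinary h.not_eventuallyPeriodic
    fun k _ => h.subsingleton_rightSpecials k).1

theorem ncard_recurrentPalindromes (h : IsSturmian w) (n : ℕ) :
    (recurrentPalindromes w n).ncard = if Even n then 1 else 2 :=
  (reversalClosed_and_ncard_recurrentPalindromes h.isBinary h.not_eventuallyPeriodic
    fun k _ => h.subsingleton_rightSpecials k).2

theorem palindrome_of_rightSpecial (h : IsSturmian w) (hu : u.Palindrome)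
    (hs : RightSpecial w u) (hv : Recurs w v) (hret : IsCompleteFirstReturn v u) :
    v.Palindrome := by
  have hr : BispecialPalindrome w u :=
    ⟨hu, hs, h.subsingleton_rightSpecials _, h.reversalClosed _⟩
  have hpal : (recurrentPalindromes w (u.length + 1)).Nonempty := by
    refine Set.nonempty_of_ncard_ne_zero ?_
    rw [h.ncard_recurrentPalindromes]
    split_ifs <;> decide
  obtain ⟨i, hi⟩ := hv.exists
  obtain ⟨k, hk⟩ := Nat.exists_eq_add_of_le' hret.length_lt.le
  have hwin := hi.window_eq hk
  rw [← hwin] at hret ⊢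
  have := hr.palindrome_of_isReturn h.isBinary
    (fun j => h.recurs_of_isFactor (window_mem_factors w j _).2) hpal
    (isCompleteFirstReturn_window_iff.1 hret)
  rwa [Nat.add_sub_cancel_left] at this

theorem palindrome_of_isCompleteFirstReturn (h : IsSturmian w) (hu : u.Palindrome)
    (hv : Recurs w v) (hret : IsCompleteFirstReturn v u) : v.Palindrome := by
  have hw := h.isBinary.finite_range
  obtain ⟨x, hx⟩ := exists_rightSpecial_append
    (fun i n => h.recurs_of_isFactor (window_mem_factors w i n).2) h.not_eventuallyPeriodic
    (hv.of_infix hret.1.isInfix)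
  induction x generalizing u v with
  | nil => exact h.palindrome_of_rightSpecial hu (by simpa using hx) hv hret
  | cons b x ih =>
    by_cases hs : RightSpecial w u
    · exact h.palindrome_of_rightSpecial hu hs hv hret
    -- Otherwise `b` is the only letter that can surround `u`, hence `v`.
    have hub : Recurs w (u ++ [b]) := (u.append_cons b x ▸ hx.recurs).left
    have hright : ∀ e, Recurs w (u ++ [e]) → e = b := fun e he =>
      eq_of_not_rightSpecial hs he hub
    have hleft : ∀ a, Recurs w (a :: u) → a = b := fun a ha => hright a <| by
      simpa [hu.reverse_eq] using h.reversalClosed _ _ rfl ha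
    obtain ⟨e, he⟩ := hv.exists_concat hw
    obtain ⟨a, ha⟩ := he.exists_cons hw
    obtain ⟨⟨y, hy⟩, ⟨x', hx'⟩, -⟩ := id hret
    obtain rfl : a = b := hleft a (ha.of_infix ⟨[], y ++ [e], by simp [← hy]⟩)
    obtain rfl : e = a := hright e (he.of_infix ⟨x', [], by simp [← hx']⟩)
    obtain ⟨d, hd⟩ := hx.exists_cons hw h.not_eventuallyPeriodic (h.subsingleton_rightSpecials _)
    obtain rfl : d = e := hleft d (hd.recurs.left (u := d :: u))
    have hpal := ih (hu.cons_concat d) ha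
      (hret.cons_concat fun a e hae =>
        ⟨hleft a (ha.of_infix hae).left, hright e (ha.of_infix hae).tail⟩)
      (by simpa using hd)
    generalize hz : d :: (v ++ [d]) = z at hpal
    cases hpal <;> simp_all

theorem isPrivileged_iff_palindrome (h : IsSturmian w) (hu : Recurs w u) :
    IsPrivileged u ↔ u.Palindrome := by
  induction hn : u.length using Nat.strong_induction_on generalizing u with
  | _ n ih =>
  subst hn
  constructor
  · intro hpriv
    cases hpriv with
    | nil => exact .nil
    | letter c => exact .singleton c
    | completeReturn _ v _ hlt hv hret =>
      exact h.palindrome_of_isCompleteFirstReturn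
        ((ih _ hlt (hu.of_infix hret.1.isInfix) rfl).1 hv) hu hret
  · refine fun hpal => isPrivileged_of_palindrome hpal fun v hv hne => ?_
    exact ih _ (hv.length_le.lt_of_ne fun hlen => hne (hv.eq_of_length hlen))
      (hu.of_infix hv.isInfix) rfl

theorem privilegedComplexity_eq (h : IsSturmian w) (n : ℕ) :
    privilegedComplexity w n = if Even n then 1 else 2 := by
  rw [← h.ncard_recurrentPalindromes n]
  refine congrArg Set.ncard (Set.ext fun u => ⟨?_, ?_⟩)
  · rintro ⟨⟨hlen, hu⟩, hpriv⟩
    have hrec := h.recurs_of_isFactor hu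
    exact ⟨hlen, hrec, (h.isPrivileged_iff_palindrome hrec).1 hpriv⟩
  · rintro ⟨hlen, hrec, hpal⟩
    exact ⟨⟨hlen, hrec.isFactor⟩, (h.isPrivileged_iff_palindrome hrec).2 hpal⟩

end IsSturmian

end SturmianWords

section PrivilegedCounts

variable {w : ℕ → A} {u v : List A} {i m n : ℕ}

/-- The privileged factors of length `n` of `w`, counted by `privilegedComplexity w n`. -/
def privilegedFactors (w : ℕ → A) (n : ℕ) : Set (List A) := {u | u ∈ factors w n ∧ IsPrivileged u}

theorem finite_privilegedFactors (hw : (Set.range w).Finite) (n : ℕ) :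
    (privilegedFactors w n).Finite :=
  (finite_factors hw n).subset fun _ hu => hu.1

theorem privilegedFactors_one (w : ℕ → A) : privilegedFactors w 1 = factors w 1 := by
  refine Set.Subset.antisymm (fun u hu => hu.1) fun u hu => ⟨hu, ?_⟩
  obtain ⟨c, rfl⟩ := List.length_eq_one_iff.1 hu.1
  exact .letter c

theorem sum_privilegedComplexity_le
    (h : ∀ u, u.length < n → IsFactor u w → u <:+: v) :
    ∑ k ∈ Finset.range n, privilegedComplexity w k ≤ v.length + 1 := by
  have hbound := encard_privileged_infix_le v
  obtain ⟨S, hS⟩ := Set.Finite.exists_finset_coe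
    (Set.finite_of_encard_le_coe (k := v.length + 1) (by exact_mod_cast hbound))
  rw [← hS, Set.encard_coe_eq_coe_finsetCard] at hbound
  calc ∑ k ∈ Finset.range n, privilegedComplexity w k
      ≤ ∑ k ∈ Finset.range n, (S.filter fun u => u.length = k).card := by
        refine Finset.sum_le_sum fun k hk => ?_
        rw [← Set.ncard_coe_finset]
        refine Set.ncard_le_ncard ?_ (Finset.finite_toSet _)
        rintro u ⟨⟨rfl, hfac⟩, hpriv⟩
        have : u ∈ (S : Set (List A)) := hS ▸ ⟨hpriv, h u (Finset.mem_range.1 hk) hfac⟩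
        simpa using this
    _ = (S.filter fun u => u.length ∈ Finset.range n).card :=
        Finset.sum_card_fiberwise_eq_card_filter S _ _
    _ ≤ S.card := Finset.card_filter_le _ _
    _ ≤ v.length + 1 := by exact_mod_cast hbound

theorem sum_range_two_mul_ite_even (m : ℕ) :
    ∑ k ∈ Finset.range (2 * m), (if Even k then 1 else 2) = 3 * m := by
  induction m with
  | zero => rfl
  | succ m ih =>
    rw [mul_add_one, Finset.sum_range_succ, Finset.sum_range_succ, ih]
    simp
    omega

theorem not_eventuallyPeriodic_of_privilegedComplexity
    (h : ∀ n, privilegedComplexity w n = if Even n then 1 else 2) : ¬ EventuallyPeriodic w := by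
  intro hper
  obtain ⟨B, hB⟩ := hper.exists_bound
  have hsum := sum_privilegedComplexity_le (w := w) (n := 2 * (B + 2))
    (v := window w 0 (B + 2 * (B + 2))) fun u hlen ⟨i, hi⟩ => by
      obtain ⟨j, hj, hwin⟩ := hB i
      rw [hi.trans (hwin _)]
      exact window_infix_window (by omega) (by omega)
  simp only [h, sum_range_two_mul_ite_even, length_window] at hsum
  omega

theorem isBinary_of_privilegedComplexity_one (h : privilegedComplexity w 1 = 2) : IsBinary w :=
  isBinary_of_ncard_factors_one ((congrArg Set.ncard (privilegedFactors_one w)).symm.trans h)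

theorem exists_isPrivileged_le_length
    (h : ∀ u, IsPrivileged u → OccursAt w u i → ∃ j > i, OccursAt w u j) (n : ℕ) :
    ∃ u, IsPrivileged u ∧ OccursAt w u i ∧ n ≤ u.length := by
  induction n with
  | zero => exact ⟨[], .nil, occursAt_nil w i, le_rfl⟩
  | succ n ih =>
    obtain ⟨u, hpriv, hu, hn⟩ := ih
    obtain ⟨y, hy, hocc⟩ := h u hpriv hu
    obtain ⟨i', j, hi, hi', hj, -, hret⟩ := exists_isReturn_straddling hu le_rfl hy hocc
    obtain rfl := hi.antisymm hi'
    obtain ⟨k, rfl⟩ := Nat.exists_eq_add_of_le hj.le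
    refine ⟨_, (isCompleteFirstReturn_window_iff.2 hret).isPrivileged hpriv,
      occursAt_window_self w i _, ?_⟩
    rw [length_window]
    omega

/-- If `u` had a last occurrence, the long privileged words read from there would not recur. -/
theorem recurs_of_forall_isPrivileged (h : ∀ u, IsFactor u w → IsPrivileged u → Recurs w u)
    (hu : IsFactor u w) : Recurs w u := by
  by_contra hnot
  have hfin : {i | OccursAt w u i}.Finite := by
    rwa [Recurs, Nat.frequently_atTop_iff_infinite, Set.not_infinite] at hnot
  obtain ⟨i, hi, hlast⟩ := Set.exists_max_image _ id hfin hu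
  obtain ⟨v, hpriv, hv, hlen⟩ := exists_isPrivileged_le_length (w := w) (i := i)
    (fun v hpriv hv => (h v ⟨i, hv⟩ hpriv).exists_ge (i + 1)) u.length
  obtain ⟨k, hk⟩ := Nat.exists_eq_add_of_le hlen
  obtain ⟨j, hj, hocc⟩ := (h v ⟨i, hv⟩ hpriv).exists_ge (i + 1)
  rw [← hv.window_eq hk, window_add, OccursAt.window_eq hi rfl] at hocc
  exact (hlast j (occursAt_append.1 hocc).1).not_gt hj

theorem recurrentPalindromes_subset_privilegedFactors
    (h : ∀ k < n, recurrentPalindromes w k = privilegedFactors w k) :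
    recurrentPalindromes w n ⊆ privilegedFactors w n := by
  rintro u ⟨rfl, hu, hpal⟩
  refine ⟨⟨rfl, hu.isFactor⟩, isPrivileged_of_palindrome hpal fun v hv hne => ?_⟩
  have hrec := hu.of_infix hv.isInfix
  have heq := Set.ext_iff.1
    (h _ (hv.length_le.lt_of_ne fun hlen => hne (hv.eq_of_length hlen))) v
  exact ⟨fun hpriv => (heq.2 ⟨⟨rfl, hrec.isFactor⟩, hpriv⟩).2.2,
    fun hpal => (heq.1 ⟨rfl, hrec, hpal⟩).2⟩

theorem subsingleton_rightSpecials_and_recurrentPalindromes_eq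
    (h : ∀ n, privilegedComplexity w n = if Even n then 1 else 2) (m : ℕ) :
    (rightSpecials w m).Subsingleton ∧ recurrentPalindromes w m = privilegedFactors w m := by
  have hb := isBinary_of_privilegedComplexity_one (h 1)
  have hper := not_eventuallyPeriodic_of_privilegedComplexity h
  induction m using Nat.strong_induction_on with
  | _ m ih =>
  have hsub := recurrentPalindromes_subset_privilegedFactors fun k hk => (ih k hk).2
  obtain ⟨hclosed, hcard⟩ :=
    reversalClosed_and_ncard_recurrentPalindromes hb hper fun k hk => (ih k hk).1
  have heq : recurrentPalindromes w m = privilegedFactors w m :=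
    Set.eq_of_subset_of_ncard_le hsub ((h m).trans hcard.symm).le
      (finite_privilegedFactors hb.finite_range m)
  refine ⟨?_, heq⟩
  obtain _ | m := m
  · rintro u ⟨hu, -⟩ v ⟨hv, -⟩
    rw [List.length_eq_zero_iff.1 hu, List.length_eq_zero_iff.1 hv]
  obtain ⟨hunique, hm⟩ := ih m m.lt_succ_self
  refine subsingleton_rightSpecials_succ hb hper hunique hclosed ?_
  have hsub : recurrentPalindromes w (m + 2) ⊆ privilegedFactors w (m + 2) :=
    recurrentPalindromes_subset_privilegedFactors fun k hk =>
      (Nat.lt_succ_iff_lt_or_eq.1 hk).elim (fun hk => (ih k hk).2) fun hk => hk ▸ heq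
  calc (recurrentPalindromes w (m + 2)).ncard
      ≤ privilegedComplexity w (m + 2) :=
        Set.ncard_le_ncard hsub (finite_privilegedFactors hb.finite_range _)
    _ = privilegedComplexity w m := by simp [h, Nat.even_add]
    _ = (recurrentPalindromes w m).ncard := congrArg Set.ncard hm.symm

theorem isSturmian_of_privilegedComplexity
    (h : ∀ n, privilegedComplexity w n = if Even n then 1 else 2) : IsSturmian w := by
  have hb := isBinary_of_privilegedComplexity_one (h 1)
  have hper := not_eventuallyPeriodic_of_privilegedComplexity h
  have hstruct := subsingleton_rightSpecials_and_recurrentPalindromes_eq h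
  have hrec : ∀ u, IsFactor u w → Recurs w u := fun u =>
    recurs_of_forall_isPrivileged fun v hv hpriv =>
      ((hstruct _).2.superset ⟨⟨rfl, hv⟩, hpriv⟩).2.1
  intro n
  rw [factorComplexity, ← recurrentWords_eq_factors hrec]
  induction n with
  | zero => exact ncard_recurrentWords_zero w
  | succ n ih =>
    obtain ⟨r, hr⟩ := rightSpecials_nonempty hb.finite_range hper n
    rw [ncard_recurrentWords_succ hb, ih, (hstruct n).1.eq_singleton_of_mem hr,
      Set.ncard_singleton]

end PrivilegedCounts

theorem mainTheorem1_general (w : ℕ → A) :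
    IsSturmian w ↔ ∀ n : ℕ, privilegedComplexity w n = if Even n then 1 else 2 :=
  ⟨IsSturmian.privilegedComplexity_eq, isSturmian_of_privilegedComplexity⟩

end PrivilegedWords

theorem mainTheorem1 {A : Type*} [Finite A] (w : ℕ → A) :
    PrivilegedWords.IsSturmian w ↔
      ∀ n : ℕ, PrivilegedWords.privilegedComplexity w n = if Even n then 1 else 2 :=
  PrivilegedWords.mainTheorem1_general w
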